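/- Let $\mathbb{H}=\mathbb{R}^3$ be the first Heisenberg group with group law $$(x_1,x_2,x_3)\boxplus(y_1,y_2,y_3)=\bigl(x_1+y_1,\;x_2+y_2,\;x_3+y_3-\tfrac12(x_1y_2-x_2y_1)\bigr),$$ and let $\|x\|_{\mathbb{H}}=\bigl((x_1^2+x_2^2)^2+16x_3^2\bigr)^{1/4}$ be the Kaplan gauge. A Lipschitz curve $\gamma=(\gamma_1,\gamma_2,\gamma_3):[a,b]\to\mathbb{H}$ is called horizontal if $\gamma'(t)\in\mathrm{span}\{(1,0,\gamma_2(t)/2),\,(0,1,-\gamma_1(t)/2)\}$ for almost every $t\in[a,b]$. For $x,y\in\mathbb{H}$ let $$d_C(x,y)=\inf_\gamma\int_a^b\sqrt{\gamma_1'(t)^2+\gamma_2'(t)^2}\,dt,$$ where the infimum is taken over all horizontal curves $\gamma:[a,b]\to\mathbb{H}$ with $\gamma(a)=x$ and $\gamma(b)=y$ (the Carnot–Carathéodory distance). Then for all $x,y\in\mathbb{H}$, $$\frac{1}{\pi^2}\,d_C(x,y)^4\;\le\;\|(-y)\boxplus x\|_{\mathbb{H}}^4\;\le\;d_C(x,y)^4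 .$$ Moreover, both inequalities are sharp: if $c\in\mathbb{R}$ satisfies $c\,d_C(x,y)^4\le\|(-y)\boxplus x\|_{\mathbb{H}}^4$ for all $x,y\in\mathbb{H}$, then $c\le 1/\pi^2$; and if $C\in\mathbb{R}$ satisfies $\|(-y)\boxplus x\|_{\mathbb{H}}^4\le C\,d_C(x,y)^4$ for all $x,y\in\mathbb{H}$, then $C\ge 1$. -/

import Mathlib

open MeasureTheory

namespace Heis

/-- The underlying space `ℝ³` of the first Heisenberg group; the coordinates
`x₁, x₂, x₃` are `x 0, x 1, x 2`. -/
abbrev Heisenberg : Type := EuclideanSpace ℝ (Fin 3)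

/-- The group law of the first Heisenberg group. -/
noncomputable def boxPlus (x y : Heisenberg) : Heisenberg :=
  !₂[x 0 + y 0, x 1 + y 1, x 2 + y 2 - (1 / 2) * (x 0 * y 1 - x 1 * y 0)]

/-- The Kaplan gauge `((x₁² + x₂²)² + 16 x₃²)^(1/4)`. -/
noncomputable def kaplanGauge (x : Heisenberg) : ℝ :=
  (((x 0) ^ 2 + (x 1) ^ 2) ^ 2 + 16 * (x 2) ^ 2) ^ (1 / 4 : ℝ)

/-- The left-invariant vector field `X₁ = ∂₁ + (x₂ / 2) ∂₃`. -/
noncomputable def vectorX1 (x : Heisenberg) : Heisenberg := !₂[1, 0, x 1 / 2]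

/-- The left-invariant vector field `X₂ = ∂₂ - (x₁ / 2) ∂₃`. -/
noncomputable def vectorX2 (x : Heisenberg) : Heisenberg := !₂[0, 1, -(x 0 / 2)]

/-- `γ` restricted to `[a, b]` is a horizontal curve: it is Lipschitz, and its derivative, which
then exists almost everywhere, lies almost everywhere in the span of `X₁` and `X₂`. -/
structure IsHorizontal (γ : ℝ → Heisenberg) (a b : ℝ) : Prop where
  lipschitz : ∃ K : NNReal, LipschitzOnWith K γ (Set.Icc a b)
  deriv_mem : ∀ᵐ t ∂(volume.restrict (Set.Icc a b)),
    deriv γ t ∈ Submodule.span ℝ {vectorX1 (γ t), vectorX2 (γ t)}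

/-- The length `∫ₐᵇ √(γ₁'(t)² + γ₂'(t)²) dt` of a horizontal curve. -/
noncomputable def horizontalLength (γ : ℝ → Heisenberg) (a b : ℝ) : ℝ :=
  ∫ t in a..b, Real.sqrt ((deriv γ t 0) ^ 2 + (deriv γ t 1) ^ 2)

/-- The Carnot-Carathéodory distance: the infimum of the lengths of the horizontal curves
connecting `x` and `y`. -/
noncomputable def ccDist (x y : Heisenberg) : ℝ :=
  sInf {L : ℝ | ∃ (a b : ℝ) (γ : ℝ → Heisenberg), a ≤ b ∧ IsHorizontal γ a b ∧
    γ a = x ∧ γ b = y ∧ L = horizontalLength γ a b}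

end Heis

/-!
Horizontal curves are compared with functions on the group by calibration: a `C¹` function whose
derivative in horizontal directions is at most `K` increases along a horizontal curve by at most
`K` times its length (`IsHorizontal.sub_le_mul_horizontalLength`, the fundamental theorem of
calculus for absolutely continuous functions).

* The horizontal gradient of the gauge has norm at most one, so the gauge distance of the endpoints
  is at most the length (`IsHorizontal.kaplanGauge_le`). Horizontal segments show that the constant
  `1` cannot be lowered.
* For the reverse inequality it suffices to exhibit one curve between any two points. Take the lift
  of one period of the prolate cycloid `(k s - r sin s, ±r (cos s - 1))`, suitably rotated. With
  `α = 2πk` the horizontal displacement, its signed area is `±(πr² + αr)`, and comparison with the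
  energy bounds the squared length by `α² + 4π²r²` (`exists_isHorizontal_length_sq_le`). Since `r`
  can be chosen to give any prescribed area, the inequality reduces to
  `(α² + 4π²r²)² ≤ π² (α⁴ + 16 (πr² + αr)²)`, which holds term by term. Using the circular arcs
  that are the geodesics would instead require solving a transcendental equation.
* Sharpness of `1 / π²` is seen on vertical displacements and amounts to the planar isoperimetric
  inequality `4πA ≤ L²` for Lipschitz loops (`IsHorizontal.isoperimetric`). It is proved by
  E. Schmidt's comparison with a circle of the same width `2r`: the vector
  `(±√(r² - (x - m)²), -(x - m))` has length `r`, so its scalar product with `(x', y')` integrates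
  to at most `rL`; choosing the sign according to the position relative to the times where `x` is
  extremal, the integral is `A + πr²`. This product is again the derivative of a calibrating
  function along the curve.
-/

namespace Heis

open Set

/-! ### Calibration along horizontal curves -/

lemma mem_span_vectorX_iff (p v : Heisenberg) :
    v ∈ Submodule.span ℝ {vectorX1 p, vectorX2 p} ↔ v 2 = (p 1 * v 0 - p 0 * v 1) / 2 := by
  rw [Submodule.mem_span_pair]
  constructor
  · rintro ⟨a, b, rfl⟩
    simp [vectorX1, vectorX2]
    ring
  · intro h
    refine ⟨v 0, v 1, ?_⟩
    ext i
    fin_cases i <;> simp [vectorX1, vectorX2, h]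
    ring

lemma IsHorizontal.intervalIntegrable_speed {γ : ℝ → Heisenberg} {a b s t : ℝ}
    (hγ : IsHorizontal γ a b) (has : a ≤ s) (hst : s ≤ t) (htb : t ≤ b) :
    IntervalIntegrable (fun τ => √((deriv γ τ 0) ^ 2 + (deriv γ τ 1) ^ 2)) volume s t := by
  obtain ⟨K, hK⟩ := hγ.lipschitz
  rw [intervalIntegrable_iff_integrableOn_Ioo_of_le hst]
  refine Measure.integrableOn_of_bounded (M := (K : ℝ)) (by simp) ?_ ?_
  · have h : Measurable (deriv γ) := measurable_deriv γ
    have h0 (i : Fin 3) : Measurable fun τ => deriv γ τ i :=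
      (measurable_pi_apply i).comp ((WithLp.measurable_ofLp 2 _).comp h)
    exact (((h0 0).pow_const 2).add ((h0 1).pow_const 2)).sqrt.aestronglyMeasurable
  · refine (ae_restrict_iff' measurableSet_Ioo).2 (Filter.Eventually.of_forall fun τ hτ => ?_)
    have h1 : ‖deriv γ τ‖ ≤ K :=
      norm_deriv_le_of_lipschitzOn
        (Icc_mem_nhds (has.trans_lt hτ.1) (hτ.2.trans_le htb)) hK
    rw [Real.norm_of_nonneg (Real.sqrt_nonneg _)]
    refine le_trans (Real.sqrt_le_sqrt ?_) ((EuclideanSpace.norm_eq _).symm.trans_le h1)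
    rw [Fin.sum_univ_three]
    simp only [Real.norm_eq_abs, sq_abs]
    nlinarith [sq_nonneg (deriv γ τ 2)]

lemma horizontalLength_nonneg (γ : ℝ → Heisenberg) {a b : ℝ} (hab : a ≤ b) :
    0 ≤ horizontalLength γ a b :=
  intervalIntegral.integral_nonneg hab fun _ _ => Real.sqrt_nonneg _

lemma IsHorizontal.horizontalLength_add {γ : ℝ → Heisenberg} {a b s t : ℝ}
    (hγ : IsHorizontal γ a b) (has : a ≤ s) (hst : s ≤ t) (htb : t ≤ b) :
    horizontalLength γ a s + horizontalLength γ s t + horizontalLength γ t b =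
      horizontalLength γ a b := by
  have h1 := hγ.intervalIntegrable_speed le_rfl has (hst.trans htb)
  have h2 := hγ.intervalIntegrable_speed has hst htb
  have h3 := hγ.intervalIntegrable_speed (has.trans hst) htb le_rfl
  unfold horizontalLength
  rw [intervalIntegral.integral_add_adjacent_intervals h1 h2,
    intervalIntegral.integral_add_adjacent_intervals (h1.trans h2) h3]

/-- Calibration: if the derivative of `Φ` in every horizontal direction `v` met by the curve is at
most `K |(v₁, v₂)|`, then `Φ` increases along the curve by at most `K` times its length. -/
lemma IsHorizontal.sub_le_mul_horizontalLength {γ : ℝ → Heisenberg} {a b s t K : ℝ}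
    (hγ : IsHorizontal γ a b) (has : a ≤ s) (hst : s ≤ t) (htb : t ≤ b)
    {Φ : Heisenberg → ℝ} (hΦ : ContDiff ℝ 1 Φ)
    (h : ∀ τ ∈ Icc a b, ∀ v, HasDerivAt γ v τ → v 2 = (γ τ 1 * v 0 - γ τ 0 * v 1) / 2 →
      ∃ d, HasDerivAt (fun τ => Φ (γ τ)) d τ ∧ d ≤ K * √((v 0) ^ 2 + (v 1) ^ 2)) :
    Φ (γ t) - Φ (γ s) ≤ K * horizontalLength γ s t := by
  obtain ⟨C, hC⟩ := hγ.lipschitz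
  have hsub : Icc s t ⊆ Icc a b := Icc_subset_Icc has htb
  obtain ⟨D, hD⟩ : ∃ D, LipschitzOnWith D Φ (γ '' Icc a b) := by
    refine LocallyLipschitzOn.exists_lipschitzOnWith_of_compact
      (isCompact_Icc.image_of_continuousOn hC.continuousOn) ?_
    exact hΦ.locallyLipschitz.locallyLipschitzOn
  have hlip : LipschitzOnWith (D * C) (fun τ => Φ (γ τ)) (uIcc s t) := by
    rw [uIcc_of_le hst]
    exact (hD.comp hC (mapsTo_image _ _)).mono hsub
  have hac := hlip.absolutelyContinuousOnInterval
  rw [← hac.integral_deriv_eq_sub, horizontalLength, ← intervalIntegral.integral_const_mul]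
  refine intervalIntegral.integral_mono_ae_restrict hst hac.intervalIntegrable_deriv
    ((hγ.intervalIntegrable_speed has hst htb).const_mul K) ?_
  have hdm := ae_restrict_of_ae_restrict_of_subset hsub hγ.deriv_mem
  have hdiff := ae_restrict_of_ae (μ := volume) (s := Icc s t) hC.ae_differentiableWithinAt_of_mem
  rw [← restrict_Ioo_eq_restrict_Icc] at hdm hdiff ⊢
  filter_upwards [hdm, hdiff, ae_restrict_mem measurableSet_Ioo] with τ h1 h2 h3
  have h4 : Icc a b ∈ nhds τ := Icc_mem_nhds (has.trans_lt h3.1) (h3.2.trans_le htb)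
  have h5 : HasDerivAt γ (deriv γ τ) τ :=
    ((h2 (mem_of_mem_nhds h4)).differentiableAt h4).hasDerivAt
  obtain ⟨d, hd, hle⟩ := h τ (mem_of_mem_nhds h4) _ h5 ((mem_span_vectorX_iff _ _).1 h1)
  rw [hd.deriv]
  exact hle

/-! ### Coordinates and the gauge -/

lemma hasDerivAt_coord {γ : ℝ → Heisenberg} {v : Heisenberg} {t : ℝ} (h : HasDerivAt γ v t)
    (i : Fin 3) : HasDerivAt (fun τ => γ τ i) (v i) t :=
  (EuclideanSpace.proj (𝕜 := ℝ) i).hasFDerivAt.comp_hasDerivAt t h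

lemma hasDerivAt_of_coord {γ : ℝ → Heisenberg} {v : Heisenberg} {t : ℝ}
    (h : ∀ i, HasDerivAt (fun τ => γ τ i) (v i) t) : HasDerivAt γ v t := by
  have h1 : HasDerivAt (fun τ => (γ τ).ofLp) v.ofLp t := hasDerivAt_pi.2 h
  exact (PiLp.continuousLinearEquiv 2 ℝ (fun _ : Fin 3 => ℝ)).symm.hasFDerivAt.comp_hasDerivAt t h1

lemma kaplanGauge_pow_four (p : Heisenberg) :
    kaplanGauge p ^ 4 = ((p 0) ^ 2 + (p 1) ^ 2) ^ 2 + 16 * (p 2) ^ 2 := by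
  rw [kaplanGauge, ← Real.rpow_natCast, ← Real.rpow_mul (by positivity)]
  norm_num

lemma kaplanGauge_boxPlus_neg_pow_four (x y : Heisenberg) :
    kaplanGauge (boxPlus (-y) x) ^ 4 = ((x 0 - y 0) ^ 2 + (x 1 - y 1) ^ 2) ^ 2 +
      16 * (x 2 - y 2 + (y 0 * x 1 - y 1 * x 0) / 2) ^ 2 := by
  rw [kaplanGauge_pow_four]
  simp [boxPlus]
  ring

/-! ### The gauge is bounded by the length -/

/-- The horizontal derivative of `gauge⁴` is at most `4 gauge³`, by the Cauchy-Schwarz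
inequality. -/
lemma horizontal_gradient_le {X Y Z n : ℝ} (hn : 0 ≤ n)
    (h : (X ^ 2 + Y ^ 2) ^ 2 + 16 * Z ^ 2 ≤ n ^ 4) (a b : ℝ) :
    -(X ^ 2 + Y ^ 2) * (X * a + Y * b) + 4 * Z * (Y * a - X * b) ≤
      n ^ 3 * √(a ^ 2 + b ^ 2) := by
  have hXY : X ^ 2 + Y ^ 2 ≤ n ^ 2 := by
    refine le_of_sq_le_sq ?_ (by positivity)
    nlinarith [sq_nonneg Z]
  refine le_trans (Real.le_sqrt_of_sq_le (y := n ^ 6 * (a ^ 2 + b ^ 2)) ?_) (le_of_eq ?_)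
  · calc (-(X ^ 2 + Y ^ 2) * (X * a + Y * b) + 4 * Z * (Y * a - X * b)) ^ 2
        ≤ ((X ^ 2 + Y ^ 2) ^ 2 + 16 * Z ^ 2) * ((X * a + Y * b) ^ 2 + (Y * a - X * b) ^ 2) := by
          linarith [sq_nonneg ((X ^ 2 + Y ^ 2) * (Y * a - X * b) + 4 * Z * (X * a + Y * b))]
      _ = ((X ^ 2 + Y ^ 2) ^ 2 + 16 * Z ^ 2) * (X ^ 2 + Y ^ 2) * (a ^ 2 + b ^ 2) := by ring
      _ ≤ n ^ 4 * n ^ 2 * (a ^ 2 + b ^ 2) := by gcongr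
      _ = n ^ 6 * (a ^ 2 + b ^ 2) := by ring
  · rw [Real.sqrt_mul (by positivity), show n ^ 6 = (n ^ 3) ^ 2 by ring,
      Real.sqrt_sq (by positivity)]

/-- The gauge grows by at most the length along a horizontal curve. The fourth root is not smooth
at the origin, so the calibrating function is `(gauge⁴ + ε) ^ (1/4)`. -/
lemma IsHorizontal.regularizedGauge_le {γ : ℝ → Heisenberg} {a b : ℝ}
    (hγ : IsHorizontal γ a b) (hab : a ≤ b) {ε : ℝ} (hε : 0 < ε) :
    (kaplanGauge (boxPlus (-γ b) (γ a)) ^ 4 + ε) ^ (1 / 4 : ℝ) ≤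
      horizontalLength γ a b + ε ^ (1 / 4 : ℝ) := by
  have hpos (p : Heisenberg) : 0 < kaplanGauge (boxPlus (-p) (γ a)) ^ 4 + ε := by
    rw [kaplanGauge_boxPlus_neg_pow_four]; positivity
  have hΦ : ContDiff ℝ 1 fun p : Heisenberg =>
      (kaplanGauge (boxPlus (-p) (γ a)) ^ 4 + ε) ^ (1 / 4 : ℝ) := by
    refine ContDiff.rpow_const_of_ne ?_ fun p => (hpos p).ne'
    simp only [kaplanGauge_boxPlus_neg_pow_four]
    fun_prop
  have key := hγ.sub_le_mul_horizontalLength (K := 1) le_rfl hab le_rfl hΦ ?_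
  · have h0 : kaplanGauge (boxPlus (-γ a) (γ a)) ^ 4 = 0 := by
      rw [kaplanGauge_boxPlus_neg_pow_four]; ring
    simp only [h0, zero_add, one_mul] at key
    linarith
  intro t _ v hv hv2
  have hx := (hasDerivAt_coord hv 0).const_sub (γ a 0)
  have hy := (hasDerivAt_coord hv 1).const_sub (γ a 1)
  have hz := ((hasDerivAt_coord hv 2).const_sub (γ a 2)).add
    ((((hasDerivAt_coord hv 0).mul_const (γ a 1)).sub
      ((hasDerivAt_coord hv 1).mul_const (γ a 0))).div_const 2)
  have hA := ((((hx.pow 2).add (hy.pow 2)).pow 2).add ((hz.pow 2).const_mul 16)).add_const ε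
  have hposA := hpos (γ t)
  simp only [kaplanGauge_boxPlus_neg_pow_four] at hposA ⊢
  have hd := hA.rpow_const (p := 1 / 4) (Or.inl hposA.ne')
  refine ⟨_, hd, ?_⟩
  simp only [Pi.add_apply, Pi.pow_apply, Pi.sub_apply] at hposA ⊢
  set X := γ a 0 - γ t 0 with hX
  set Y := γ a 1 - γ t 1 with hY
  set Z := γ a 2 - γ t 2 + (γ t 0 * γ a 1 - γ t 1 * γ a 0) / 2 with hZ
  set f := (X ^ 2 + Y ^ 2) ^ 2 + 16 * Z ^ 2 + ε with hf
  set n := f ^ (1 / 4 : ℝ) with hn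
  have hnpos : 0 < n := Real.rpow_pos_of_pos hposA _
  have hn4 : n ^ 4 = f := by
    rw [hn, ← Real.rpow_natCast, ← Real.rpow_mul hposA.le]; norm_num
  have hn3 : f ^ (1 / 4 - 1 : ℝ) = (n ^ 3)⁻¹ := by
    rw [Real.rpow_sub hposA, Real.rpow_one, ← hn, ← hn4]; field_simp
  rw [hn3, one_mul]
  have hW : -v 2 + (v 0 * γ a 1 - v 1 * γ a 0) / 2 = (Y * v 0 - X * v 1) / 2 := by
    rw [hv2, hX, hY]; ring
  rw [hW]
  have hmain := horizontal_gradient_le hnpos.le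
    (show (X ^ 2 + Y ^ 2) ^ 2 + 16 * Z ^ 2 ≤ n ^ 4 by linarith) (v 0) (v 1)
  rw [← div_eq_mul_inv, div_le_iff₀ (by positivity)]
  norm_num
  linarith

lemma IsHorizontal.kaplanGauge_le {γ : ℝ → Heisenberg} {a b : ℝ}
    (hγ : IsHorizontal γ a b) (hab : a ≤ b) :
    kaplanGauge (boxPlus (-γ b) (γ a)) ≤ horizontalLength γ a b := by
  have h0 : 0 ≤ kaplanGauge (boxPlus (-γ b) (γ a)) := by
    rw [kaplanGauge]; positivity
  have hcont : ContinuousAt (fun ε : ℝ => horizontalLength γ a b + ε ^ (1 / 4 : ℝ)) 0 :=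
    continuousAt_const.add (Real.continuousAt_rpow_const _ _ (Or.inr (by norm_num)))
  have hlim := hcont.tendsto.mono_left (nhdsWithin_le_nhds (s := Ioi 0))
  rw [Real.zero_rpow (by norm_num), add_zero] at hlim
  refine ge_of_tendsto hlim ?_
  filter_upwards [self_mem_nhdsWithin] with ε hε
  refine le_trans ?_ (hγ.regularizedGauge_le hab hε)
  calc kaplanGauge (boxPlus (-γ b) (γ a))
      = (kaplanGauge (boxPlus (-γ b) (γ a)) ^ 4) ^ (1 / 4 : ℝ) := by
        rw [← Real.rpow_natCast, ← Real.rpow_mul h0]; norm_num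
    _ ≤ _ := Real.rpow_le_rpow (by positivity) (le_add_of_nonneg_right (le_of_lt hε)) (by norm_num)

/-! ### The isoperimetric inequality -/

/-- The primitive, vanishing at `0`, of the height `√(r² - u²)` of the half-disc of radius `r`
(extended by zero outside `[-r, r]`). -/
noncomputable def halfDiscArea (r x : ℝ) : ℝ := ∫ u in (0 : ℝ)..x, √(r ^ 2 - u ^ 2)

lemma hasDerivAt_halfDiscArea (r x : ℝ) :
    HasDerivAt (halfDiscArea r) (√(r ^ 2 - x ^ 2)) x :=
  (Continuous.integral_hasStrictDerivAt (by fun_prop) 0 x).hasDerivAt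

lemma contDiff_halfDiscArea (r : ℝ) : ContDiff ℝ 1 (halfDiscArea r) := by
  rw [contDiff_one_iff_deriv]
  refine ⟨fun x => (hasDerivAt_halfDiscArea r x).differentiableAt, ?_⟩
  rw [funext fun x => (hasDerivAt_halfDiscArea r x).deriv]
  fun_prop

lemma halfDiscArea_sub {r : ℝ} (hr : 0 ≤ r) :
    halfDiscArea r r - halfDiscArea r (-r) = Real.pi * r ^ 2 / 2 := by
  have hint (x y : ℝ) : IntervalIntegrable (fun u => √(r ^ 2 - u ^ 2)) volume x y :=
    Continuous.intervalIntegrable (by fun_prop) x y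
  rw [halfDiscArea, halfDiscArea, intervalIntegral.integral_interval_sub_left (hint _ _) (hint _ _)]
  have h := intervalIntegral.mul_integral_comp_mul_left (f := fun u => √(r ^ 2 - u ^ 2))
    (a := -1) (b := 1) (c := r)
  rw [mul_neg_one, mul_one] at h
  rw [← h]
  have h1 (u : ℝ) : √(r ^ 2 - (r * u) ^ 2) = r * √(1 - u ^ 2) := by
    rw [show r ^ 2 - (r * u) ^ 2 = r ^ 2 * (1 - u ^ 2) by ring, Real.sqrt_mul (by positivity),
      Real.sqrt_sq hr]
  simp only [h1, intervalIntegral.integral_const_mul, integral_sqrt_one_sub_sq]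
  ring

/-- The increment along a horizontal curve of the function
`p₃ - (p₁ - 2m) p₂ / 2 + σ P(p₁ - m)`, where `P` is the primitive of the half-disc height. Its
derivative is `-(x - m) y' + σ √(r² - (x - m)²) x'`, the scalar product of `(x', y')` with a vector
of length `r`. -/
lemma IsHorizontal.diskCalibration_le {γ : ℝ → Heisenberg} {a b s t m r σ : ℝ}
    (hγ : IsHorizontal γ a b) (has : a ≤ s) (hst : s ≤ t) (htb : t ≤ b) (hr : 0 ≤ r)
    (hσ : σ ^ 2 = 1) (hm : ∀ τ ∈ Icc a b, |γ τ 0 - m| ≤ r) :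
    (γ t 2 - (γ t 0 - 2 * m) * γ t 1 / 2 + σ * halfDiscArea r (γ t 0 - m)) -
      (γ s 2 - (γ s 0 - 2 * m) * γ s 1 / 2 + σ * halfDiscArea r (γ s 0 - m)) ≤
      r * horizontalLength γ s t := by
  have hΦ : ContDiff ℝ 1 fun p : Heisenberg =>
      p 2 - (p 0 - 2 * m) * p 1 / 2 + σ * halfDiscArea r (p 0 - m) := by
    have h1 : ContDiff ℝ 1 fun p : Heisenberg => halfDiscArea r (p 0 - m) :=
      (contDiff_halfDiscArea r).comp (by fun_prop)
    fun_prop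
  refine hγ.sub_le_mul_horizontalLength has hst htb hΦ ?_
  intro τ hτ v hv hv2
  have hx := hasDerivAt_coord hv 0
  have hy := hasDerivAt_coord hv 1
  have hz := hasDerivAt_coord hv 2
  refine ⟨_, (hz.sub (((hx.sub_const (2 * m)).mul hy).div_const 2)).add
    (((hasDerivAt_halfDiscArea r _).comp τ (hx.sub_const m)).const_mul σ), ?_⟩
  have hmτ : (γ τ 0 - m) ^ 2 ≤ r ^ 2 := sq_le_sq' (abs_le.1 (hm τ hτ)).1 (abs_le.1 (hm τ hτ)).2
  set w := √(r ^ 2 - (γ τ 0 - m) ^ 2) with hw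
  have hw2 : w ^ 2 = r ^ 2 - (γ τ 0 - m) ^ 2 := Real.sq_sqrt (by linarith)
  have hd : v 2 - (v 0 * γ τ 1 + (γ τ 0 - 2 * m) * v 1) / 2 + σ * (w * v 0) =
      σ * w * v 0 - (γ τ 0 - m) * v 1 := by
    rw [hv2]; ring
  rw [hd]
  refine le_trans (Real.le_sqrt_of_sq_le (y := r ^ 2 * (v 0 ^ 2 + v 1 ^ 2)) ?_) (le_of_eq ?_)
  · have h1 : (σ * w) ^ 2 + (γ τ 0 - m) ^ 2 = r ^ 2 := by rw [mul_pow, hσ, hw2]; ring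
    rw [← h1]
    nlinarith [sq_nonneg (σ * w * v 1 + (γ τ 0 - m) * v 0)]
  · rw [Real.sqrt_mul (by positivity), Real.sqrt_sq hr]

/-- The isoperimetric inequality for horizontal curves with closed planar projection, whose
height gain is the signed area enclosed by the projection. -/
lemma IsHorizontal.isoperimetric {γ : ℝ → Heisenberg} {a b : ℝ} (hγ : IsHorizontal γ a b)
    (hab : a ≤ b) (h0 : γ b 0 = γ a 0) (h1 : γ b 1 = γ a 1) :
    4 * Real.pi * (γ b 2 - γ a 2) ≤ horizontalLength γ a b ^ 2 := by
  obtain ⟨C, hC⟩ := hγ.lipschitz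
  have hcont : ContinuousOn (fun τ => γ τ 0) (Icc a b) :=
    (EuclideanSpace.proj (𝕜 := ℝ) (0 : Fin 3)).continuous.comp_continuousOn hC.continuousOn
  obtain ⟨s, hs, hsmin⟩ := isCompact_Icc.exists_isMinOn (nonempty_Icc.2 hab) hcont
  obtain ⟨t, ht, htmax⟩ := isCompact_Icc.exists_isMaxOn (nonempty_Icc.2 hab) hcont
  have hmin (τ : ℝ) (hτ : τ ∈ Icc a b) : γ s 0 ≤ γ τ 0 := hsmin hτ
  have hmax (τ : ℝ) (hτ : τ ∈ Icc a b) : γ τ 0 ≤ γ t 0 := htmax hτ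
  set m := (γ s 0 + γ t 0) / 2 with hm
  set r := (γ t 0 - γ s 0) / 2 with hr
  have hr0 : 0 ≤ r := by linarith [hmin t ht]
  have hmr (τ : ℝ) (hτ : τ ∈ Icc a b) : |γ τ 0 - m| ≤ r := by
    rw [abs_le]; constructor <;> linarith [hmin τ hτ, hmax τ hτ]
  have hsm : γ s 0 - m = -r := by rw [hm, hr]; ring
  have htm : γ t 0 - m = r := by rw [hm, hr]; ring
  have hP := halfDiscArea_sub hr0
  -- The half circles are joined to a full one by changing sign at the two extremal times.
  have key : γ b 2 - γ a 2 + Real.pi * r ^ 2 ≤ r * horizontalLength γ a b := by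
    rcases le_total s t with hst | hst
    · have e1 := hγ.diskCalibration_le (σ := -1) le_rfl hs.1 hs.2 hr0 (by norm_num) hmr
      have e2 := hγ.diskCalibration_le (σ := 1) hs.1 hst ht.2 hr0 (by norm_num) hmr
      have e3 := hγ.diskCalibration_le (σ := -1) ht.1 ht.2 le_rfl hr0 (by norm_num) hmr
      rw [← hγ.horizontalLength_add hs.1 hst ht.2]
      rw [hsm] at e1 e2
      rw [htm] at e2 e3
      rw [h0, h1] at e3
      linarith
    · have e1 := hγ.diskCalibration_le (σ := 1) le_rfl ht.1 ht.2 hr0 (by norm_num) hmr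
      have e2 := hγ.diskCalibration_le (σ := -1) ht.1 hst hs.2 hr0 (by norm_num) hmr
      have e3 := hγ.diskCalibration_le (σ := 1) hs.1 hs.2 le_rfl hr0 (by norm_num) hmr
      rw [← hγ.horizontalLength_add ht.1 hst hs.2]
      rw [hsm] at e2 e3
      rw [htm] at e1 e2
      rw [h0, h1] at e3
      linarith
  nlinarith [sq_nonneg (horizontalLength γ a b - 2 * Real.pi * r),
    mul_le_mul_of_nonneg_left key Real.pi_pos.le]

/-! ### Lifts of prolate cycloids -/

/-- The horizontal curve starting at `x` whose planar projection is `x` plus the image of the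
prolate cycloid `(k s - r sin s, σ r (cos s - 1))` under the rotation with matrix
`(p, -q; q, p)`. -/
noncomputable def cycloidLift (x : Heisenberg) (p q k r σ s : ℝ) : Heisenberg :=
  let u := k * s - r * Real.sin s
  let v := σ * r * (Real.cos s - 1)
  !₂[x 0 + (p * u - q * v), x 1 + (q * u + p * v),
    x 2 + (x 1 * (p * u - q * v) - x 0 * (q * u + p * v)) / 2 +
      σ * ((r * k + r ^ 2) * (Real.sin s - s) + r * k * (Real.sin s - s * Real.cos s)) / 2]

/-- The derivative of `cycloidLift` in `s`. -/
noncomputable def cycloidVelocity (x : Heisenberg) (p q k r σ s : ℝ) : Heisenberg :=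
  let u := k - r * Real.cos s
  let v := -(σ * r * Real.sin s)
  !₂[p * u - q * v, q * u + p * v,
    (x 1 * (p * u - q * v) - x 0 * (q * u + p * v)) / 2 +
      σ * ((r * k + r ^ 2) * (Real.cos s - 1) + r * k * (s * Real.sin s)) / 2]

lemma hasDerivAt_cycloidLift (x : Heisenberg) (p q k r σ s : ℝ) :
    HasDerivAt (cycloidLift x p q k r σ) (cycloidVelocity x p q k r σ s) s := by
  have hs := Real.hasDerivAt_sin s
  have hc := Real.hasDerivAt_cos s
  have hi := hasDerivAt_id' s
  have hu := (hi.const_mul k).sub (hs.const_mul r)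
  have hv := (hc.sub_const 1).const_mul (σ * r)
  have h0 := (hu.const_mul p).sub (hv.const_mul q)
  have h1 := (hu.const_mul q).add (hv.const_mul p)
  refine hasDerivAt_of_coord fun i => ?_
  fin_cases i
  · exact (h0.const_add (x 0)).congr_deriv (by simp [cycloidVelocity])
  · exact (h1.const_add (x 1)).congr_deriv (by simp [cycloidVelocity])
  · refine HasDerivAt.congr_deriv ((((h0.const_mul (x 1)).sub (h1.const_mul (x 0))).div_const 2 |>.const_add (x 2)).add
      (((((hs.sub hi).const_mul (r * k + r ^ 2)).add
        ((hs.sub (hi.mul hc)).const_mul (r * k))).const_mul σ).div_const 2)) ?_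
    simp [cycloidVelocity]

lemma isHorizontal_cycloidLift (x : Heisenberg) {p q : ℝ} (k r σ a b : ℝ)
    (hpq : p ^ 2 + q ^ 2 = 1) :
    IsHorizontal (cycloidLift x p q k r σ) a b where
  lipschitz := by
    have h : ContDiff ℝ 1 (cycloidLift x p q k r σ) := by
      refine contDiff_euclidean.2 fun i => ?_
      fin_cases i <;> simp [cycloidLift] <;> fun_prop
    exact h.contDiffOn.exists_lipschitzOnWith one_ne_zero (convex_Icc a b) isCompact_Icc
  deriv_mem := by
    refine Filter.Eventually.of_forall fun s => ?_
    rw [(hasDerivAt_cycloidLift x p q k r σ s).deriv, mem_span_vectorX_iff]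
    simp [cycloidLift, cycloidVelocity]
    have h1 := Real.sin_sq_add_cos_sq s
    linear_combination (σ * r ^ 2 * (p ^ 2 + q ^ 2) / 2) * h1 -
      σ * ((r * k + r ^ 2) * (Real.cos s - 1) + r * k * (s * Real.sin s)) / 2 * hpq

lemma horizontalLength_cycloidLift_le (x : Heisenberg) {p q σ k r : ℝ}
    (hpq : p ^ 2 + q ^ 2 = 1) (hσ : σ ^ 2 = 1) :
    horizontalLength (cycloidLift x p q k r σ) 0 (2 * Real.pi) ≤
      2 * Real.pi * √(k ^ 2 + r ^ 2) := by
  have hspeed (s : ℝ) : √((deriv (cycloidLift x p q k r σ) s 0) ^ 2 +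
      (deriv (cycloidLift x p q k r σ) s 1) ^ 2) = √(k ^ 2 + r ^ 2 - 2 * k * r * Real.cos s) := by
    rw [(hasDerivAt_cycloidLift x p q k r σ s).deriv]
    congr 1
    simp [cycloidVelocity]
    have h1 := Real.sin_sq_add_cos_sq s
    linear_combination ((k - r * Real.cos s) ^ 2 + (σ * r * Real.sin s) ^ 2) * hpq +
      r ^ 2 * Real.sin s ^ 2 * hσ + r ^ 2 * h1
  -- Concavity of the square root: its tangent line at `k² + r²` dominates it.
  have hle (s : ℝ) : √(k ^ 2 + r ^ 2 - 2 * k * r * Real.cos s) ≤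
      √(k ^ 2 + r ^ 2) - k * r / √(k ^ 2 + r ^ 2) * Real.cos s := by
    set w := √(k ^ 2 + r ^ 2) with hw
    have hw2 : w ^ 2 = k ^ 2 + r ^ 2 := Real.sq_sqrt (by positivity)
    have hw0 : 0 ≤ w := Real.sqrt_nonneg _
    rcases hw0.eq_or_lt with h | h
    · rw [← h] at hw2 ⊢
      have hk : k = 0 := by nlinarith
      have hr : r = 0 := by nlinarith
      simp [hk, hr]
    · have hkr : |k * r * Real.cos s| ≤ w ^ 2 := by
        rw [abs_mul]
        have h2 : |k * r| ≤ w ^ 2 := by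
          rw [hw2, abs_le]; constructor <;> nlinarith [sq_nonneg (k + r), sq_nonneg (k - r)]
        nlinarith [Real.abs_cos_le_one s, abs_nonneg (k * r)]
      refine Real.sqrt_le_iff.2 ⟨?_, ?_⟩
      · rw [sub_nonneg, div_mul_eq_mul_div, div_le_iff₀ h]
        nlinarith [le_abs_self (k * r * Real.cos s)]
      · have : (w - k * r / w * Real.cos s) ^ 2 =
            w ^ 2 - 2 * k * r * Real.cos s + (k * r / w * Real.cos s) ^ 2 := by
          field_simp; ring
        rw [this, hw2]
        nlinarith [sq_nonneg (k * r / w * Real.cos s)]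
  unfold horizontalLength
  simp only [hspeed]
  refine (intervalIntegral.integral_mono (by positivity)
    (Continuous.intervalIntegrable (by fun_prop) _ _)
    (Continuous.intervalIntegrable (by fun_prop) _ _) hle).trans (le_of_eq ?_)
  rw [intervalIntegral.integral_sub (Continuous.intervalIntegrable (by fun_prop) _ _)
    (Continuous.intervalIntegrable (by fun_prop) _ _), intervalIntegral.integral_const_mul]
  simp

/-- Any two points are joined by the lift of one period of a prolate cycloid. Its horizontal
displacement is `α` and its signed area `±(π r² + α r)`. -/
lemma exists_isHorizontal_length_sq_le (x y : Heisenberg) {α r : ℝ} (hα : 0 ≤ α)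
    (hα2 : α ^ 2 = (y 0 - x 0) ^ 2 + (y 1 - x 1) ^ 2)
    (hr : Real.pi * r ^ 2 + α * r = |y 2 - x 2 - (x 1 * y 0 - x 0 * y 1) / 2|) :
    ∃ γ : ℝ → Heisenberg, IsHorizontal γ 0 (2 * Real.pi) ∧ γ 0 = x ∧ γ (2 * Real.pi) = y ∧
      horizontalLength γ 0 (2 * Real.pi) ^ 2 ≤ α ^ 2 + 4 * Real.pi ^ 2 * r ^ 2 := by
  have hpi := Real.pi_pos
  obtain ⟨p, q, hpq, hp, hq⟩ : ∃ p q : ℝ, p ^ 2 + q ^ 2 = 1 ∧ α * p = y 0 - x 0 ∧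
      α * q = y 1 - x 1 := by
    rcases hα.eq_or_lt with h | h
    · rw [← h] at hα2
      exact ⟨1, 0, by norm_num, by nlinarith, by nlinarith⟩
    · refine ⟨(y 0 - x 0) / α, (y 1 - x 1) / α, ?_, by field_simp, by field_simp⟩
      field_simp
      linarith
  obtain ⟨σ, hσ, hT⟩ : ∃ σ : ℝ, σ ^ 2 = 1 ∧
      y 2 - x 2 - (x 1 * y 0 - x 0 * y 1) / 2 = -σ * (Real.pi * r ^ 2 + α * r) := by
    rw [hr]
    rcases abs_cases (y 2 - x 2 - (x 1 * y 0 - x 0 * y 1) / 2) with h | h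
    · exact ⟨-1, by norm_num, by linarith [h.1]⟩
    · exact ⟨1, by norm_num, by linarith [h.1]⟩
  have hk : 2 * Real.pi * (α / (2 * Real.pi)) = α := by field_simp
  refine ⟨cycloidLift x p q (α / (2 * Real.pi)) r σ,
    isHorizontal_cycloidLift x _ _ _ _ _ hpq, ?_, ?_, ?_⟩
  · ext i
    fin_cases i <;> simp [cycloidLift]
  · generalize α / (2 * Real.pi) = k at hk
    ext i
    fin_cases i <;> simp [cycloidLift]
    · linear_combination hp + p * hk
    · linear_combination hq + q * hk
    · linear_combination -hT + (x 1 * hp - x 0 * hq) / 2 + ((x 1 * p - x 0 * q) / 2 - σ * r) * hk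
  · have h1 := horizontalLength_cycloidLift_le x (k := α / (2 * Real.pi)) (r := r) hpq hσ
    have h0 := horizontalLength_nonneg (cycloidLift x p q (α / (2 * Real.pi)) r σ)
      (a := 0) (b := 2 * Real.pi) (by positivity)
    refine (pow_le_pow_left₀ h0 h1 2).trans (le_of_eq ?_)
    rw [mul_pow, Real.sq_sqrt (by positivity)]
    field_simp
    ring

/-! ### Bounds for the Carnot-Carathéodory distance -/

lemma ccDist_le_horizontalLength {γ : ℝ → Heisenberg} {a b : ℝ} (hab : a ≤ b)
    (hγ : IsHorizontal γ a b) : ccDist (γ a) (γ b) ≤ horizontalLength γ a b := by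
  refine csInf_le ⟨0, ?_⟩ ⟨a, b, γ, hab, hγ, rfl, rfl, rfl⟩
  rintro _ ⟨a', b', γ', hab', -, -, -, rfl⟩
  exact horizontalLength_nonneg γ' hab'

lemma ccDist_nonneg (x y : Heisenberg) : 0 ≤ ccDist x y := by
  refine Real.sInf_nonneg ?_
  rintro _ ⟨a, b, γ, hab, -, -, -, rfl⟩
  exact horizontalLength_nonneg γ hab

/-- The radius in `exists_isHorizontal_length_sq_le`, solved for. -/
lemma exists_pi_mul_sq_add_mul_eq {α T : ℝ} (hT : 0 ≤ T) :
    ∃ r : ℝ, 0 ≤ r ∧ Real.pi * r ^ 2 + α * r = T := by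
  have hpi := Real.pi_pos
  have hd : 0 ≤ α ^ 2 + 4 * Real.pi * T := by positivity
  have h2 := Real.sq_sqrt hd
  refine ⟨(√(α ^ 2 + 4 * Real.pi * T) - α) / (2 * Real.pi), ?_, ?_⟩
  · refine div_nonneg (sub_nonneg.2 (Real.le_sqrt_of_sq_le ?_)) (by positivity)
    nlinarith [mul_nonneg hpi.le hT]
  · set w := √(α ^ 2 + 4 * Real.pi * T)
    have h3 : Real.pi * ((w - α) / (2 * Real.pi)) ^ 2 + α * ((w - α) / (2 * Real.pi)) =
        (w ^ 2 - α ^ 2) / (4 * Real.pi) := by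
      field_simp; ring
    rw [h3, h2]
    field_simp; ring

/-- A lower bound for the lengths of all curves bounds `ccDist`: the set of lengths is nonempty, so
its infimum takes no junk value. -/
lemma le_ccDist {x y : Heisenberg} {d : ℝ} (h : ∀ (a b : ℝ) (γ : ℝ → Heisenberg), a ≤ b →
    IsHorizontal γ a b → γ a = x → γ b = y → d ≤ horizontalLength γ a b) : d ≤ ccDist x y := by
  refine le_csInf ?_ ?_
  · obtain ⟨r, -, hr⟩ := exists_pi_mul_sq_add_mul_eq
      (α := √((y 0 - x 0) ^ 2 + (y 1 - x 1) ^ 2)) (abs_nonneg _)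
    obtain ⟨γ, hγ, h0, h1, -⟩ := exists_isHorizontal_length_sq_le x y (Real.sqrt_nonneg _)
      (Real.sq_sqrt (by positivity)) hr
    exact ⟨_, 0, 2 * Real.pi, γ, by positivity, hγ, h0, h1, rfl⟩
  · rintro _ ⟨a, b, γ, hab, hγ, h0, h1, rfl⟩
    exact h a b γ hab hγ h0 h1

lemma ccDist_sq_le (x y : Heisenberg) {α r : ℝ} (hα : 0 ≤ α)
    (hα2 : α ^ 2 = (y 0 - x 0) ^ 2 + (y 1 - x 1) ^ 2)
    (hr : Real.pi * r ^ 2 + α * r = |y 2 - x 2 - (x 1 * y 0 - x 0 * y 1) / 2|) :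
    ccDist x y ^ 2 ≤ α ^ 2 + 4 * Real.pi ^ 2 * r ^ 2 := by
  obtain ⟨γ, hγ, rfl, rfl, hL⟩ := exists_isHorizontal_length_sq_le x y hα hα2 hr
  exact (pow_le_pow_left₀ (ccDist_nonneg _ _)
    (ccDist_le_horizontalLength (by positivity) hγ) 2).trans hL

/-- With `r` as in `ccDist_sq_le`, the claim is
`(α² + 4π²r²)² ≤ π² (α⁴ + 16 (πr² + αr)²)`, in which every coefficient on the right is at least
the corresponding one on the left. -/
lemma ccDist_pow_four_le (x y : Heisenberg) :
    ccDist x y ^ 4 ≤ Real.pi ^ 2 * kaplanGauge (boxPlus (-y) x) ^ 4 := by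
  have hpi := Real.pi_pos
  have hα := Real.sqrt_nonneg ((y 0 - x 0) ^ 2 + (y 1 - x 1) ^ 2)
  have hα2 := Real.sq_sqrt (show 0 ≤ (y 0 - x 0) ^ 2 + (y 1 - x 1) ^ 2 by positivity)
  set α := √((y 0 - x 0) ^ 2 + (y 1 - x 1) ^ 2)
  obtain ⟨r, hr0, hr⟩ := exists_pi_mul_sq_add_mul_eq (α := α)
    (abs_nonneg (y 2 - x 2 - (x 1 * y 0 - x 0 * y 1) / 2))
  have hd := ccDist_sq_le x y hα hα2 hr
  have hg : kaplanGauge (boxPlus (-y) x) ^ 4 =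
      α ^ 4 + 16 * (Real.pi * r ^ 2 + α * r) ^ 2 := by
    rw [kaplanGauge_boxPlus_neg_pow_four, hr, sq_abs, show α ^ 4 = (α ^ 2) ^ 2 by ring, hα2]
    ring
  rw [hg]
  have hpi1 : 1 ≤ Real.pi ^ 2 := by nlinarith [Real.pi_gt_three]
  calc ccDist x y ^ 4 = (ccDist x y ^ 2) ^ 2 := by ring
    _ ≤ (α ^ 2 + 4 * Real.pi ^ 2 * r ^ 2) ^ 2 := by gcongr
    _ ≤ Real.pi ^ 2 * α ^ 4 + 16 * Real.pi ^ 2 * (Real.pi * r ^ 2 + α * r) ^ 2 := by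
      have h1 : 0 ≤ (Real.pi ^ 2 - 1) * α ^ 4 := mul_nonneg (by linarith) (by positivity)
      have h2 : 0 ≤ Real.pi ^ 3 * α * r ^ 3 := by positivity
      have h3 : 0 ≤ Real.pi ^ 2 * α ^ 2 * r ^ 2 := by positivity
      nlinarith
    _ = _ := by ring

lemma kaplanGauge_le_ccDist (x y : Heisenberg) :
    kaplanGauge (boxPlus (-y) x) ≤ ccDist x y := by
  refine le_ccDist fun a b γ hab hγ h0 h1 => ?_
  subst h0 h1
  exact hγ.kaplanGauge_le hab

/-- The vertical direction, where `gauge⁴ = 16`, is extremal for the lower bound. -/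
lemma four_pi_le_ccDist_sq : 4 * Real.pi ≤ ccDist 0 !₂[0, 0, 1] ^ 2 := by
  refine (Real.sqrt_le_left (ccDist_nonneg _ _)).1 (le_ccDist fun a b γ hab hγ h0 h1 => ?_)
  refine Real.sqrt_le_iff.2 ⟨horizontalLength_nonneg γ hab, ?_⟩
  have h := hγ.isoperimetric hab (by simp [h0, h1]) (by simp [h0, h1])
  simpa [h0, h1] using h

lemma ccDist_zero_horizontal_le : ccDist 0 !₂[1, 0, 0] ^ 2 ≤ 1 := by
  have h := ccDist_sq_le 0 !₂[1, 0, 0] (α := 1) (r := 0) (by norm_num) (by simp) (by simp)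
  simpa using h

end Heis

theorem mainTheorem8 :
    (∀ x y : Heis.Heisenberg,
      (1 / Real.pi ^ 2) * Heis.ccDist x y ^ 4 ≤ Heis.kaplanGauge (Heis.boxPlus (-y) x) ^ 4 ∧
      Heis.kaplanGauge (Heis.boxPlus (-y) x) ^ 4 ≤ Heis.ccDist x y ^ 4) ∧
    (∀ c : ℝ,
      (∀ x y : Heis.Heisenberg,
        c * Heis.ccDist x y ^ 4 ≤ Heis.kaplanGauge (Heis.boxPlus (-y) x) ^ 4) →
      c ≤ 1 / Real.pi ^ 2) ∧
    (∀ C : ℝ,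
      (∀ x y : Heis.Heisenberg,
        Heis.kaplanGauge (Heis.boxPlus (-y) x) ^ 4 ≤ C * Heis.ccDist x y ^ 4) →
      1 ≤ C) := by
  have hpi := Real.pi_pos
  refine ⟨fun x y => ⟨?_, ?_⟩, fun c hc => ?_, fun C hC => ?_⟩
  · rw [one_div, inv_mul_le_iff₀ (by positivity)]
    exact Heis.ccDist_pow_four_le x y
  · have h0 : 0 ≤ Heis.kaplanGauge (Heis.boxPlus (-y) x) := by
      rw [Heis.kaplanGauge]; positivity
    exact pow_le_pow_left₀ h0 (Heis.kaplanGauge_le_ccDist x y) 4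
  · have h := hc 0 !₂[0, 0, 1]
    rw [Heis.kaplanGauge_boxPlus_neg_pow_four] at h
    simp at h
    rw [le_div_iff₀ (by positivity)]
    rcases le_total c 0 with hc0 | hc0
    · nlinarith [mul_nonneg (neg_nonneg.2 hc0) (sq_nonneg Real.pi)]
    · have h1 := pow_le_pow_left₀ (by positivity) Heis.four_pi_le_ccDist_sq 2
      nlinarith [mul_le_mul_of_nonneg_left h1 hc0]
  · have h := hC 0 !₂[1, 0, 0]
    rw [Heis.kaplanGauge_boxPlus_neg_pow_four] at h
    simp at h
    have h1 := Heis.ccDist_zero_horizontal_le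
    have h2 : Heis.ccDist 0 !₂[1, 0, 0] ^ 4 ≤ 1 := by
      nlinarith [sq_nonneg (Heis.ccDist 0 !₂[1, 0, 0])]
    have h3 : 0 ≤ Heis.ccDist 0 !₂[1, 0, 0] ^ 4 := by positivity
    by_contra! hlt
    rcases le_total C 0 with hC0 | hC0
    · linarith [mul_nonpos_of_nonpos_of_nonneg hC0 h3]
    · linarith [mul_le_mul_of_nonneg_left h2 hC0]
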